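/- Let $d\ge 1$ be an integer, $\mathbb{D}=\{z\in\mathbb{C}:|z|<1\}$, and let $A_{\mathrm{sym}}(\mathbb{D}^d)$ be the complex unital commutative Banach algebra (with pointwise operations and the supremum norm) of all continuous functions $f:\overline{\mathbb{D}}^d\to\mathbb{C}$ that are holomorphic in $\mathbb{D}^d$ and symmetric, i.e. $f(z_{\sigma(1)},\dots,z_{\sigma(d)})=f(z_1,\dots,z_d)$ for all $(z_1,\dots,z_d)\in\mathbb{D}^d$ and all permutations $\sigma$ of $\{1,\dots,d\}$. Let $M$ be the maximal ideal space of $A_{\mathrm{sym}}(\mathbb{D}^d)$, i.e. the set of all nonzero complex algebra homomorphisms $\varphi:A_{\mathrm{sym}}(\mathbb{D}^d)\to\mathbb{C}$ (each of which is automatically continuous), endowed with the Gelfand topology, i.e. the topology induced from the weak-$*$ topology of the dual space of $A_{\mathrm{sym}}(\mathbb{D}^d)$. Then $M$ is contractible: there exist a point $\varphi_0\in M$ and a continuous map $H:[0,1]\times M\to M$ such that $H(0,\varphi)=\varphi$ and $H(1,\varphi)=\varphi_0$ for all $\varphi\in M$. -/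

import Mathlib

/-- The open polydisc `𝔻^d` in `ℂ^d`. -/
def openPolydisc (d : ℕ) : Set (Fin d → ℂ) := {z | ∀ i, ‖z i‖ < 1}

/-- The closed polydisc in `ℂ^d`, the closure of `𝔻^d`. -/
def closedPolydisc (d : ℕ) : Set (Fin d → ℂ) := {z | ∀ i, ‖z i‖ ≤ 1}

theorem openPolydisc_subset_closedPolydisc (d : ℕ) : openPolydisc d ⊆ closedPolydisc d :=
  fun _ hz i => (hz i).le

/-- The closed polydisc is compact, so that `C(closedPolydisc d, ℂ)` carries the supremum norm. -/
instance closedPolydisc_compactSpace (d : ℕ) : CompactSpace (closedPolydisc d) := by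
  rw [← isCompact_iff_compactSpace]
  have h : closedPolydisc d = Set.univ.pi fun _ => Metric.closedBall (0 : ℂ) 1 := by
    ext z
    simp [closedPolydisc]
  rw [h]
  exact isCompact_univ_pi fun _ => isCompact_closedBall _ _

/-- The action of `S_d` on the closed polydisc, `σ z = (z_{σ(1)}, …, z_{σ(d)})`. -/
def permPoint {d : ℕ} (σ : Equiv.Perm (Fin d)) (z : closedPolydisc d) : closedPolydisc d :=
  ⟨fun i => z.1 (σ i), fun i => z.2 (σ i)⟩

/-- `f`, defined on the closed polydisc, is holomorphic in the open polydisc. -/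
def IsHolomorphicInside {d : ℕ} (f : closedPolydisc d → ℂ) : Prop :=
  ∃ g : (Fin d → ℂ) → ℂ, DifferentiableOn ℂ g (openPolydisc d) ∧
    ∀ z : closedPolydisc d, z.1 ∈ openPolydisc d → f z = g z.1

/-- `f(σ z) = f(z)` for all `z ∈ 𝔻^d` and all permutations `σ`. -/
def IsSymmetricInside {d : ℕ} (f : closedPolydisc d → ℂ) : Prop :=
  ∀ z : closedPolydisc d, z.1 ∈ openPolydisc d →
    ∀ σ : Equiv.Perm (Fin d), f z = f (permPoint σ z)

/-- The polydisc algebra `A(𝔻^d)`: continuous on the closed polydisc and holomorphic in `𝔻^d`,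
with pointwise operations and the supremum norm. -/
def polydiscAlgebra (d : ℕ) : Subalgebra ℂ C(closedPolydisc d, ℂ) where
  carrier := {f | IsHolomorphicInside f}
  mul_mem' := by
    rintro f₁ f₂ ⟨g₁, h₁, e₁⟩ ⟨g₂, h₂, e₂⟩
    exact ⟨g₁ * g₂, h₁.mul h₂, fun z hz => by simp [e₁ z hz, e₂ z hz]⟩
  add_mem' := by
    rintro f₁ f₂ ⟨g₁, h₁, e₁⟩ ⟨g₂, h₂, e₂⟩
    exact ⟨g₁ + g₂, h₁.add h₂, fun z hz => by simp [e₁ z hz, e₂ z hz]⟩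
  algebraMap_mem' c := ⟨fun _ => c, differentiableOn_const c, fun _ _ => by simp⟩

/-- The algebra `A_sym(𝔻^d)` of symmetric functions in the polydisc algebra, with the same
operations and norm. -/
def symPolydiscAlgebra (d : ℕ) : Subalgebra ℂ C(closedPolydisc d, ℂ) where
  carrier := {f | f ∈ polydiscAlgebra d ∧ IsSymmetricInside f}
  mul_mem' := by
    rintro f₁ f₂ ⟨h₁, s₁⟩ ⟨h₂, s₂⟩
    exact ⟨mul_mem h₁ h₂, fun z hz σ => by simp [← s₁ z hz σ, ← s₂ z hz σ]⟩
  add_mem' := by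
    rintro f₁ f₂ ⟨h₁, s₁⟩ ⟨h₂, s₂⟩
    exact ⟨add_mem h₁ h₂, fun z hz σ => by simp [← s₁ z hz σ, ← s₂ z hz σ]⟩
  algebraMap_mem' c := ⟨(polydiscAlgebra d).algebraMap_mem c, fun _ _ _ => by simp⟩

/-!
The dilations `f ↦ f((1 - t) ·)`, `0 ≤ t ≤ 1`, are endomorphisms of `A_sym(𝔻^d)` that join the
identity to evaluation at the origin. Composing a character `φ` with them moves `φ` to evaluation at
the origin. This is continuous in `t` and `φ` jointly because `t ↦ f((1 - t) ·)` is continuous in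
the supremum norm and characters are contractive, hence equicontinuous. Contractivity follows from
continuity: if `‖φ a‖ > ‖a‖`, then `b = (φ a)⁻¹ • a` satisfies `b ^ n → 0` although `φ (b ^ n) = 1`.
-/

open Filter Topology unitInterval
open WeakDual (characterSpace)
open WeakDual.CharacterSpace (toAlgHom toCLM eq_set_map_one_map_mul continuousMapEval)

section Comap

variable {𝕜 A B : Type*} [CommRing 𝕜] [NoZeroDivisors 𝕜] [Nontrivial 𝕜] [TopologicalSpace 𝕜]
  [IsTopologicalRing 𝕜] [Semiring A] [TopologicalSpace A] [Algebra 𝕜 A] [Semiring B]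
  [TopologicalSpace B] [Algebra 𝕜 B]

/-- The map of character spaces induced by a continuous algebra homomorphism `ψ`, sending `φ` to
`φ ∘ ψ`. -/
noncomputable def characterSpaceComap (ψ : A →A[𝕜] B) (φ : characterSpace 𝕜 B) :
    characterSpace 𝕜 A :=
  ⟨StrongDual.toWeakDual ((toCLM φ).comp ψ.toContinuousLinearMap), by
    rw [eq_set_map_one_map_mul]
    exact ⟨map_one ((toAlgHom φ).comp ψ.toAlgHom), map_mul ((toAlgHom φ).comp ψ.toAlgHom)⟩⟩

theorem characterSpaceComap_apply (ψ : A →A[𝕜] B) (φ : characterSpace 𝕜 B) (a : A) :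
    characterSpaceComap ψ φ a = φ (ψ a) :=
  rfl

end Comap

section CharacterSpace

variable {𝕜 A : Type*} [NormedField 𝕜] [SeminormedRing A] [NormedAlgebra 𝕜 A]

theorem norm_characterSpace_apply_le (φ : characterSpace 𝕜 A) (a : A) : ‖φ a‖ ≤ ‖a‖ := by
  by_contra! h
  have hφa : φ a ≠ 0 := norm_pos_iff.1 ((norm_nonneg a).trans_lt h)
  set b := (φ a)⁻¹ • a with hb
  have hφb : φ b = 1 := by rw [hb, map_smul, smul_eq_mul, inv_mul_cancel₀ hφa]
  have hb_lt : ‖b‖ < 1 := by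
    rw [hb, norm_smul, norm_inv, inv_mul_lt_one₀ (norm_pos_iff.2 hφa)]
    exact h
  have hlim : Tendsto (fun n : ℕ => φ (b ^ n)) atTop (𝓝 (φ 0)) :=
    ((map_continuous φ).tendsto 0).comp (tendsto_pow_atTop_nhds_zero_of_norm_lt_one hb_lt)
  simp only [map_pow, hφb, one_pow, map_zero, tendsto_const_nhds_iff, one_ne_zero] at hlim

theorem continuous_characterSpace_apply :
    Continuous fun p : characterSpace 𝕜 A × A => p.1 p.2 :=
  continuous_prod_of_continuous_lipschitzWith' _ 1
    (fun φ => LipschitzWith.of_dist_le_mul fun a b => by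
      simpa only [NNReal.coe_one, one_mul, dist_eq_norm, map_sub]
        using norm_characterSpace_apply_le φ (a - b))
    (fun a => (WeakDual.eval_continuous a).comp continuous_subtype_val)

theorem continuous_characterSpaceComap {B T : Type*} [Semiring B] [TopologicalSpace B] [Algebra 𝕜 B]
    [TopologicalSpace T] {Ψ : T → B →A[𝕜] A} (hΨ : ∀ b, Continuous fun t => Ψ t b) :
    Continuous fun p : T × characterSpace 𝕜 A => characterSpaceComap (Ψ p.1) p.2 :=
  Continuous.subtype_mk
    (WeakDual.continuous_of_continuous_eval fun b =>
      continuous_characterSpace_apply.comp (continuous_snd.prodMk ((hΨ b).comp continuous_fst))) _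

theorem contractibleSpace_characterSpace_of_endomorphisms {Ψ : I → A →A[𝕜] A}
    (hΨ : ∀ a, Continuous fun t => Ψ t a) (φ₀ : characterSpace 𝕜 A) (hΨ_zero : ∀ a, Ψ 0 a = a)
    (hΨ_one : ∀ a, Ψ 1 a = algebraMap 𝕜 A (φ₀ a)) : ContractibleSpace (characterSpace 𝕜 A) := by
  let H : ContinuousMap.Homotopy (.id (characterSpace 𝕜 A)) (.const _ φ₀) :=
    { toFun := fun p => characterSpaceComap (Ψ p.1) p.2
      continuous_toFun := continuous_characterSpaceComap hΨ
      map_zero_left := fun φ => WeakDual.CharacterSpace.ext fun a => by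
        simp [characterSpaceComap_apply, hΨ_zero]
      map_one_left := fun φ => WeakDual.CharacterSpace.ext fun a => by
        simp [characterSpaceComap_apply, hΨ_one, AlgHomClass.commutes] }
  exact (contractible_iff_id_nullhomotopic _).2 ⟨φ₀, ⟨H⟩⟩

end CharacterSpace

section FunctionAlgebra

variable {𝕜 X : Type*} [TopologicalSpace X]

/-- Precomposition with `g`, as an endomorphism of an algebra of functions that it preserves. -/
def precompEndomorphism [CommSemiring 𝕜] [TopologicalSpace 𝕜] [IsTopologicalSemiring 𝕜]
    {S : Subalgebra 𝕜 C(X, 𝕜)} (g : C(X, X)) (hg : ∀ f ∈ S, f.comp g ∈ S) : S →A[𝕜] S :=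
  ContinuousAlgHom.codRestrict
    ((⟨ContinuousMap.compRightAlgHom 𝕜 𝕜 g, ContinuousMap.compRightAlgHom_continuous 𝕜 𝕜 g⟩ :
      C(X, 𝕜) →A[𝕜] C(X, 𝕜)).comp S.valA) S fun f => hg f f.2

theorem contractibleSpace_characterSpace_of_homotopy [NormedField 𝕜] [CompactSpace X]
    {S : Subalgebra 𝕜 C(X, 𝕜)} {x₀ : X} (H : ContinuousMap.Homotopy (.id X) (.const X x₀))
    (hS : ∀ t, ∀ f ∈ S, f.comp (H.curry t) ∈ S) :
    ContractibleSpace (characterSpace 𝕜 S) := by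
  refine contractibleSpace_characterSpace_of_endomorphisms
    (Ψ := fun t => precompEndomorphism (H.curry t) (hS t)) (fun f => ?_)
    (characterSpaceComap S.valA (continuousMapEval X 𝕜 x₀)) (fun f => ?_) (fun f => ?_)
  · exact ((ContinuousMap.continuous_postcomp f.1).comp H.curry.continuous).subtype_mk _
  · exact Subtype.ext (ContinuousMap.ext fun x => congrArg f.1 (H.apply_zero x))
  · exact Subtype.ext (ContinuousMap.ext fun x => congrArg f.1 (H.apply_one x))

end FunctionAlgebra

section Polydisc

variable {d : ℕ}

theorem norm_unitInterval_smul_le {E : Type*} [SeminormedAddCommGroup E] [NormedSpace ℝ E] (r : I)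
    (x : E) : ‖(r : ℝ) • x‖ ≤ ‖x‖ := by
  rw [norm_smul, Real.norm_of_nonneg r.2.1]
  exact mul_le_of_le_one_left (norm_nonneg x) r.2.2

theorem unitInterval_smul_mem_openPolydisc (r : I) {z : Fin d → ℂ} (hz : z ∈ openPolydisc d) :
    (r : ℝ) • z ∈ openPolydisc d :=
  fun i => (norm_unitInterval_smul_le r (z i)).trans_lt (hz i)

theorem unitInterval_smul_mem_closedPolydisc (r : I) {z : Fin d → ℂ} (hz : z ∈ closedPolydisc d) :
    (r : ℝ) • z ∈ closedPolydisc d :=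
  fun i => (norm_unitInterval_smul_le r (z i)).trans (hz i)

/-- The contraction `(t, z) ↦ (1 - t) z` of the closed polydisc to its centre. -/
noncomputable def closedPolydiscContraction (d : ℕ) :
    ContinuousMap.Homotopy (.id (closedPolydisc d)) (.const _ ⟨0, fun _ => by simp⟩) where
  toFun p := ⟨(σ p.1 : ℝ) • p.2.1, unitInterval_smul_mem_closedPolydisc (σ p.1) p.2.2⟩
  continuous_toFun := by fun_prop
  map_zero_left z := by simp
  map_one_left z := by simp

theorem IsHolomorphicInside.comp_closedPolydiscContraction {f : closedPolydisc d → ℂ}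
    (hf : IsHolomorphicInside f) (t : I) :
    IsHolomorphicInside (f ∘ (closedPolydiscContraction d).curry t) := by
  obtain ⟨g, hg, hfg⟩ := hf
  refine ⟨fun z => g ((σ t : ℝ) • z), ?_, fun z hz => ?_⟩
  · exact hg.comp (by fun_prop) fun z hz => unitInterval_smul_mem_openPolydisc (σ t) hz
  · exact hfg _ (unitInterval_smul_mem_openPolydisc (σ t) hz)

theorem IsSymmetricInside.comp_closedPolydiscContraction {f : closedPolydisc d → ℂ}
    (hf : IsSymmetricInside f) (t : I) :
    IsSymmetricInside (f ∘ (closedPolydiscContraction d).curry t) :=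
  fun _ hz τ => hf _ (unitInterval_smul_mem_openPolydisc (σ t) hz) τ

end Polydisc

/-- The maximal ideal space of `A_sym(𝔻^d)` (the nonzero multiplicative functionals, with the
topology induced by the weak-* topology of the dual) is contractible. -/
theorem theorem4p1 (d : ℕ) (hd : 1 ≤ d) :
    ContractibleSpace (WeakDual.characterSpace ℂ (symPolydiscAlgebra d)) := by
  exact contractibleSpace_characterSpace_of_homotopy (closedPolydiscContraction d)
    fun t _ hf => ⟨hf.1.comp_closedPolydiscContraction t, hf.2.comp_closedPolydiscContraction t⟩
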